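/- **Setting.** Let $J,K\ge 0$ be integers and let $\mathcal X_1,\dots,\mathcal X_J$ be separable metric spaces with at least two points, with their Borel $\sigma$-algebras. Let $G$ be a directed graph on the vertices $H_1,\dots,H_K$ (latent) and $X_1,\dots,X_J$ (observed). Write $\Lambda$ for the graph induced by $G$ on the latent vertices, and $\Gamma=(\gamma_{j,k})\in\{0,1\}^{J\times K}$ for the matrix with $\gamma_{j,k}=1$ iff $H_k\to X_j$ is an edge of $G$. A *binary latent causal model* (BLCM) on $G$ is a probability distribution $\mathbb P$ of $(H,X)\in\{0,1\}^K\times\prod_j\mathcal X_j$ such that * $G$ is acyclic and no edge of $G$ starts at an observed vertex; * (causal Markov property) $\mathbb P(H,X)=\prod_k\mathbb P(H_k\mid \mathrm{pa}(H_k))\prod_j\mathbb P(X_j\mid\mathrm{pa}(X_j))$; * (faithfulness) for pairwise disjoint sets $A,B,C$ of vertices, the variables in $A$ and those in $B$ are conditionally independent given those in $C$ under $\mathbb P$ if and only if $A$ and $B$ are d-separated by $C$ in $G$; * $\pi_h:=\mathbb P(H=h)>0$ for all $h\in\{0,1\}^K$; for each $j$, the conditional distributions $\mathbb P(X_j\mid\mathrm{pa}(X_j)=a)$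 are distinct for distinct values $a$ of the parents; and each $H_k$ has at least one observed child. Write $\mathbb P_{j,h}$ for the conditional distribution of $X_j$ given $H=h$. A $K\times K$ binary matrix is *triangular* if some permutations of its rows and of its columns make it lower triangular with ones on the diagonal. The matrix $\Gamma$ is *double triangular* if, after a permutation of its rows, it consists of three blocks $\Gamma_1,\Gamma_2,\Gamma_3$ stacked on top of each other, where $\Gamma_1,\Gamma_2$ are triangular $K\times K$ matrices (possibly with different column permutations) and $\Gamma_3$ is formed by the remaining rows. The matrix $\Gamma$ satisfies the *subset condition* if for all $k\ne l$ the set of observed children of $H_k$ is not contained in that of $H_l$. **Theorem.** Let $\mathbb P$ be a BLCM on $G$ with $K$ latent variables whose matrix $\Gamma$ is double triangular, with blocks $\Gamma_1,\Gamma_2,\Gamma_3$ such that $\Gamma_3$ has no zero column. Let $\widetilde{\mathbb P}$ be an arbitrary BLCM on an arbitrary graph $\widetilde G$, with the same number $K$ of latent variables and the same observed distribution, $\widetilde{\mathbb P}(X)=\mathbb P(X)$. Denote its components by $\widetilde\Lambda,\widetilde\Gamma,\widetilde\pi,\widetilde{\mathbb P}_{j,h}$. 1. There is a permutation $\sigma$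 of $\{1,\dots,K\}$ with $\gamma_{j,k}=\widetilde\gamma_{j,\sigma(k)}$ for all $j,k$. 2. If $\Gamma$ also satisfies the subset condition, then there are a permutation $\sigma$ of $\{1,\dots,K\}$ and permutations $\tau_1,\dots,\tau_K$ of $\{0,1\}$ such that, with $\widetilde h$ defined by $\widetilde h_{\sigma(k)}=\tau_k(h_k)$, $$\gamma_{j,k}=\widetilde\gamma_{j,\sigma(k)},\qquad \pi_h=\widetilde\pi_{\widetilde h},\qquad \mathbb P_{j,h}=\widetilde{\mathbb P}_{j,\widetilde h}\qquad\text{for all } j,k,\ h\in\{0,1\}^K,$$ and $\Lambda$ is Markov equivalent to $\widetilde\Lambda$ after relabelling by $\sigma$: for pairwise disjoint $A,B,C\subseteq\{1,\dots,K\}$, $A$ and $B$ are d-separated by $C$ in $\Lambda$ if and only if $\sigma(A)$ and $\sigma(B)$ are d-separated by $\sigma(C)$ in $\widetilde\Lambda$. -/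

import Mathlib

open MeasureTheory
open scoped ProbabilityTheory

namespace BLCM

noncomputable section

/-! ### Directed graphs and d-separation -/

/-- `G` is a directed acyclic graph: no vertex can be reached from itself by a nonempty
directed path. -/
def IsAcyclic {V : Type*} (G : Digraph V) : Prop :=
  ∀ v, ¬ Relation.TransGen G.Adj v v

/-- The vertices `p 0, …, p n` form a path of `G` (pairwise distinct, consecutive ones joined by an
edge in some direction) that is active given `C`: every interior collider of the path has a
descendant (possibly itself) in `C`, and no interior non-collider lies in `C`. -/
structure IsActivePath {V : Type*} (G : Digraph V) (C : Set V) (n : ℕ) (p : ℕ → V) : Prop where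
  injOn : Set.InjOn p (Set.Iic n)
  adj : ∀ i < n, G.Adj (p i) (p (i + 1)) ∨ G.Adj (p (i + 1)) (p i)
  collider : ∀ i, i + 2 ≤ n → (G.Adj (p i) (p (i + 1)) ∧ G.Adj (p (i + 2)) (p (i + 1))) →
    ∃ c ∈ C, Relation.ReflTransGen G.Adj (p (i + 1)) c
  nonCollider : ∀ i, i + 2 ≤ n → ¬ (G.Adj (p i) (p (i + 1)) ∧ G.Adj (p (i + 2)) (p (i + 1))) →
    p (i + 1) ∉ C

/-- `A` and `B` are d-separated by `C` in `G`. -/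
def DSep {V : Type*} (G : Digraph V) (A B C : Set V) : Prop :=
  ∀ a ∈ A, ∀ b ∈ B, ¬ ∃ (n : ℕ) (p : ℕ → V), p 0 = a ∧ p n = b ∧ IsActivePath G C n p

/-! ### The graph of a latent variable model

The vertex `Sum.inl k` is the latent variable `H_k` and `Sum.inr j` is the observed variable
`X_j`. -/

/-- The latent graph `Λ`: the edges of `G` among the latent variables. -/
def latentGraph {J K : ℕ} (G : Digraph (Fin K ⊕ Fin J)) : Digraph (Fin K) where
  Adj k l := G.Adj (Sum.inl k) (Sum.inl l)

open Classical in
/-- The bipartite adjacency matrix `Γ`: its `(j, k)` entry indicates whether `H_k → X_j` is an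
edge. -/
def gamma {J K : ℕ} (G : Digraph (Fin K ⊕ Fin J)) : Matrix (Fin J) (Fin K) Bool :=
  fun j k => decide (G.Adj (Sum.inl k) (Sum.inr j))

/-- The latent parents of a vertex. -/
def latentParents {J K : ℕ} (G : Digraph (Fin K ⊕ Fin J)) (v : Fin K ⊕ Fin J) : Set (Fin K) :=
  {k | G.Adj (Sum.inl k) v}

/-! ### Distributions of the vertex variables -/

/-- The space of joint values of all the variables: a latent configuration in `{0,1}^K` together
with values of the observed variables. -/
abbrev Outcome (K : ℕ) {J : ℕ} (X : Fin J → Type*) : Type _ :=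
  (Fin K → Bool) × (∀ j, X j)

section

variable {J K : ℕ} {X : Fin J → Type*} [∀ j, MeasurableSpace (X j)]

/-- The σ-algebra generated by the variable at one vertex. -/
abbrev vertexSigma (v : Fin K ⊕ Fin J) : MeasurableSpace (Outcome K X) :=
  match v with
  | Sum.inl k => MeasurableSpace.comap (fun ω => ω.1 k) inferInstance
  | Sum.inr j => MeasurableSpace.comap (fun ω => ω.2 j) inferInstance

/-- The σ-algebra generated by the variables at the vertices in `S`. -/
abbrev sigmaOf (X : Fin J → Type*) [∀ j, MeasurableSpace (X j)] (S : Set (Fin K ⊕ Fin J)) :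
    MeasurableSpace (Outcome K X) :=
  ⨆ v ∈ S, vertexSigma v

/-- Under `P`, the variables in `A` are conditionally independent of those in `B` given those in
`C`. -/
def CondIndep (P : Measure (Outcome K X)) (A B C : Set (Fin K ⊕ Fin J)) : Prop :=
  ∀ s t : Set (Outcome K X), MeasurableSet[sigmaOf X A] s → MeasurableSet[sigmaOf X B] t →
    P⟦s ∩ t | sigmaOf X C⟧ =ᵐ[P] P⟦s | sigmaOf X C⟧ * P⟦t | sigmaOf X C⟧

/-- The event that the latent variables indexed by `S` take the values prescribed by `h`. -/
def latentEvent (X : Fin J → Type*) (S : Set (Fin K)) (h : Fin K → Bool) : Set (Outcome K X) :=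
  {ω | ∀ k ∈ S, ω.1 k = h k}

/-- The conditional distribution of `X_j` given that the latent variables indexed by `S` take the
values prescribed by `h`. -/
def condLaw (P : Measure (Outcome K X)) (j : Fin J) (S : Set (Fin K)) (h : Fin K → Bool) :
    Measure (X j) :=
  (P[|latentEvent X S h]).map (fun ω => ω.2 j)

/-- The latent proportion `π_h = P(H = h)`. -/
def proportion (P : Measure (Outcome K X)) (h : Fin K → Bool) : ENNReal :=
  P (latentEvent X Set.univ h)

/-- `P_{j,h}`, the conditional distribution of `X_j` given `H = h`. -/
def obsLaw (P : Measure (Outcome K X)) (j : Fin J) (h : Fin K → Bool) : Measure (X j) :=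
  condLaw P j Set.univ h

/-- The distribution of the observed variables. -/
def observed (P : Measure (Outcome K X)) : Measure (∀ j, X j) :=
  P.map Prod.snd

/-- `P` is (the distribution of) a binary latent causal model on the graph `G`. -/
structure IsBLCM (G : Digraph (Fin K ⊕ Fin J)) (P : Measure (Outcome K X)) : Prop where
  isProbabilityMeasure : IsProbabilityMeasure P
  acyclic : IsAcyclic G
  /-- Measurement model: no edge leaves an observed variable. -/
  measurement : ∀ (j : Fin J) (v : Fin K ⊕ Fin J), ¬ G.Adj (Sum.inr j) v
  /-- Causal Markov property: the joint distribution is the product of the conditional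
  distributions of the variables given their parents. -/
  markov : ∀ (h : Fin K → Bool) (A : ∀ j, Set (X j)), (∀ j, MeasurableSet (A j)) →
    P {ω | ω.1 = h ∧ ∀ j, ω.2 j ∈ A j} =
      (∏ k, P[{ω | ω.1 k = h k} | latentEvent X (latentParents G (Sum.inl k)) h]) *
        ∏ j, condLaw P j (latentParents G (Sum.inr j)) h (A j)
  /-- Faithfulness: the conditional independence relations of `P` are those embedded in `G`. -/
  faithful : ∀ A B C : Set (Fin K ⊕ Fin J), Disjoint A B → Disjoint A C → Disjoint B C →
    (CondIndep P A B C ↔ DSep G A B C)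
  /-- Every latent configuration has positive probability. -/
  proportion_pos : ∀ h, 0 < proportion P h
  /-- Different configurations of the parents of `X_j` give different conditional distributions
  of `X_j`. -/
  condLaw_ne : ∀ (j : Fin J) (h h' : Fin K → Bool),
    (∃ k ∈ latentParents G (Sum.inr j), h k ≠ h' k) →
      condLaw P j (latentParents G (Sum.inr j)) h ≠ condLaw P j (latentParents G (Sum.inr j)) h'
  /-- Every latent variable has an observed child. -/
  exists_child : ∀ k, ∃ j, G.Adj (Sum.inl k) (Sum.inr j)

end

/-! ### Conditions on the bipartite matrix -/

/-- A square binary matrix is triangular if suitable permutations of its rows and of its columns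
make it lower triangular with ones on the diagonal. -/
def IsTriangular {K : ℕ} (M : Matrix (Fin K) (Fin K) Bool) : Prop :=
  ∃ ρ c : Equiv.Perm (Fin K),
    (∀ i, M (ρ i) (c i) = true) ∧ ∀ i l, i < l → M (ρ i) (c l) = false

/-- `r₁` and `r₂` select two disjoint families of `K` rows of `Γ`, both forming triangular
matrices, so that `Γ` is double triangular with blocks `Γ₁` (rows `r₁`), `Γ₂` (rows `r₂`) and `Γ₃`
(all the other rows). -/
def IsDoubleTriangularAlong {J K : ℕ} (Γ : Matrix (Fin J) (Fin K) Bool)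
    (r₁ r₂ : Fin K ↪ Fin J) : Prop :=
  Disjoint (Set.range r₁) (Set.range r₂) ∧
    IsTriangular (Γ.submatrix r₁ id) ∧ IsTriangular (Γ.submatrix r₂ id)

/-- The block of the rows of `Γ` that are selected neither by `r₁` nor by `r₂` has no empty
column. -/
def RemainderHasNoEmptyColumn {J K : ℕ} (Γ : Matrix (Fin J) (Fin K) Bool)
    (r₁ r₂ : Fin K ↪ Fin J) : Prop :=
  ∀ k, ∃ j, j ∉ Set.range r₁ ∧ j ∉ Set.range r₂ ∧ Γ j k = true

/-- The subset condition: no column of `Γ` (set of observed children of a latent variable) is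
contained in another one. -/
def SubsetCondition {J K : ℕ} (Γ : Matrix (Fin J) (Fin K) Bool) : Prop :=
  ∀ k l, k ≠ l → ¬ {j | Γ j k = true} ⊆ {j | Γ j l = true}

/-! ### Identifiability -/

/-- The latent configuration obtained from `h` by renaming the latent variable `k` to `σ k`, after
exchanging its two values or not according to `τ k`. -/
def relabel {K : ℕ} (σ : Equiv.Perm (Fin K)) (τ : Fin K → Equiv.Perm Bool) (h : Fin K → Bool) :
    Fin K → Bool :=
  fun k => τ (σ.symm k) (h (σ.symm k))

/-- The latent graphs `L` and `L'` are Markov equivalent after renaming the vertex `k` of `L` to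
`σ k`: they induce the same conditional independence relations. -/
def MarkovEquivAlong {K : ℕ} (σ : Equiv.Perm (Fin K)) (L L' : Digraph (Fin K)) : Prop :=
  ∀ A B C : Set (Fin K), Disjoint A B → Disjoint A C → Disjoint B C →
    (DSep L A B C ↔ DSep L' (σ '' A) (σ '' B) (σ '' C))

section

variable {J K : ℕ} {X : Fin J → Type*} [∀ j, MeasurableSpace (X j)]

/-- Equivalence of two models up to label permutation, sign flips and Markov equivalence. -/
def ModelEquiv (G : Digraph (Fin K ⊕ Fin J)) (P : Measure (Outcome K X))
    (G' : Digraph (Fin K ⊕ Fin J)) (P' : Measure (Outcome K X)) : Prop :=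
  ∃ (σ : Equiv.Perm (Fin K)) (τ : Fin K → Equiv.Perm Bool),
    (∀ j k, gamma G j k = gamma G' j (σ k)) ∧
    MarkovEquivAlong σ (latentGraph G) (latentGraph G') ∧
    (∀ h, proportion P h = proportion P' (relabel σ τ h)) ∧
    (∀ j h, obsLaw P j h = obsLaw P' j (relabel σ τ h))

/-- With `K` known, `Γ` is identifiable up to label permutation: every model with `K` binary latent
variables and the same observed distribution has the same `Γ` up to a permutation of columns. -/
def GammaIdentifiable (G : Digraph (Fin K ⊕ Fin J)) (P : Measure (Outcome K X)) : Prop :=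
  ∀ (G' : Digraph (Fin K ⊕ Fin J)) (P' : Measure (Outcome K X)),
    IsBLCM G' P' → observed P = observed P' →
      ∃ σ : Equiv.Perm (Fin K), ∀ j k, gamma G j k = gamma G' j (σ k)

/-- With `K` known, all model components are identifiable up to label permutation, sign flips and
Markov equivalence. -/
def ComponentsIdentifiable (G : Digraph (Fin K ⊕ Fin J)) (P : Measure (Outcome K X)) : Prop :=
  ∀ (G' : Digraph (Fin K ⊕ Fin J)) (P' : Measure (Outcome K X)),
    IsBLCM G' P' → observed P = observed P' → ModelEquiv G P G' P'

end

end

end BLCM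

/-!
The observed distribution is a mixture of `2 ^ K` product measures, indexed by the latent
configurations `h`, with weights `π_h` and factors `P_{j,h}`. Split the observed variables into the
rows of `Γ₁`, those of `Γ₂` and the others. A triangular block makes the product measures of its
variables linearly independent in `h` (`eq_zero_of_triangular`), because its variables can be
ordered so that each one depends on a single further latent variable. The third block, having no
empty column, has pairwise distinct product measures. This is the situation of Kruskal's theorem in
which two of the three factors have full rank, and simultaneous diagonalisation
(`exists_perm_of_sum_eq`) shows that every other mixture of `2 ^ K` product measures with the same
sum has the same components up to a permutation `R` of `{0,1}^K` (`exists_perm_components`); nothing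
is assumed about the matrix of the second model.

The law `P_{j,h}` determines exactly the values in `h` of the parents of `X_j`. Hence `R` matches,
for each set of observed variables, the partitions of the cube according to the values of their
parents. The sizes of the cells give, for each set of rows, the number of columns of `Γ` supported
in it, and therefore the multiset of columns (`exists_perm_columns`). Under the subset condition the
variables that are not children of `H_k` have together all other latent variables as parents, so
`R` preserves agreement off one coordinate, and such a permutation of the cube is a permutation of
coordinates followed by flips (`apply_eq_iff`, `exists_relabel_eq`).

Finally, conditional independence among latent variables depends on the proportions only
(`condIndep_inl_iff`), and d-separation of latent variables given latent variables is the same in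
`G` and in its latent part, as observed variables are childless (`dSep_inl_iff`). Faithfulness of
both models then gives Markov equivalence.
-/

namespace BLCM


/-! ### Uniqueness of a three-way decomposition -/

lemma sum_mul_finsuppSum_congr {ι β : Type*} [Fintype ι] {b b' : ι → ℝ} {v v' : β → ι → ℝ}
    (h : ∀ y, ∑ i, b i * v y i = ∑ i, b' i * v' y i) (c : β →₀ ℝ) :
    ∑ i, b i * c.sum (fun y r => r * v y i) = ∑ i, b' i * c.sum (fun y r => r * v' y i) := by
  have key : ∀ (b : ι → ℝ) (v : β → ι → ℝ),
      ∑ i, b i * c.sum (fun y r => r * v y i) = c.sum fun y r => r * ∑ i, b i * v y i := by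
    intro b v
    simp only [Finsupp.sum, Finset.mul_sum]
    rw [Finset.sum_comm]
    exact Finset.sum_congr rfl fun y _ => Finset.sum_congr rfl fun i _ => by ring
  rw [key, key]
  simp only [h]

/-- A family of vectors that no nonzero coefficient vector annihilates spans `ι → ℝ`, so the
standard basis vectors are finite combinations of it. -/
lemma exists_finsuppSum_eq_single {ι β : Type*} [Fintype ι] [DecidableEq ι] {v : β → ι → ℝ}
    (hv : ∀ a : ι → ℝ, (∀ y, ∑ i, a i * v y i = 0) → a = 0) (j : ι) :
    ∃ c : β →₀ ℝ, ∀ i, c.sum (fun y r => r * v y i) = if i = j then 1 else 0 := by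
  have htop : Submodule.span ℝ (Set.range v) = ⊤ := by
    by_contra hne
    obtain ⟨f, hf, hle⟩ := Submodule.exists_le_ker_of_lt_top _ (lt_top_iff_ne_top.2 hne)
    have hf0 : (fun i => f (Pi.single i 1)) = 0 := hv _ fun y => by
      have hy : f (v y) = 0 := hle (Submodule.subset_span ⟨y, rfl⟩)
      rw [LinearMap.pi_apply_eq_sum_univ f (v y)] at hy
      rw [← hy]
      refine Finset.sum_congr rfl fun i _ => ?_
      rw [smul_eq_mul, mul_comm]
      congr 2
      ext k
      simp [Pi.single_apply, eq_comm]
    apply hf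
    ext i
    simpa using congrFun hf0 i
  have hmem : (Pi.single j 1 : ι → ℝ) ∈ Submodule.span ℝ (Set.range v) := htop ▸ trivial
  obtain ⟨c, hc⟩ := (Finsupp.mem_span_range_iff_exists_finsupp).1 hmem
  refine ⟨c, fun i => ?_⟩
  have := congrFun hc i
  simpa [Finsupp.sum, Finset.sum_apply, Pi.single_apply] using this

/-- The case of Kruskal's theorem that simultaneous diagonalisation proves. Two sums of `card ι`
product terms are equal; if in the first one the factors `u` and `v` are each linearly independent
in the index `i` and the factors `w` are pairwise distinct, then the terms of the two sums agree up
to a permutation. The indices `x₀`, `y₀`, `z₀` give the normalisation of the factors. -/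
theorem exists_perm_of_sum_eq {ι α β γ : Type*} [Fintype ι] [DecidableEq ι]
    {a a' : ι → ℝ} {u u' : α → ι → ℝ} {v v' : β → ι → ℝ} {w w' : γ → ι → ℝ}
    (ha : ∀ i, a i ≠ 0)
    (hu : ∀ b : ι → ℝ, (∀ x, ∑ i, b i * u x i = 0) → b = 0)
    (hv : ∀ b : ι → ℝ, (∀ y, ∑ i, b i * v y i = 0) → b = 0)
    (hw : ∀ i j, (∀ z, w z i = w z j) → i = j)
    {x₀ : α} {y₀ : β} {z₀ : γ}
    (hu₀ : ∀ i, u x₀ i = 1) (hu₀' : ∀ i, u' x₀ i = 1)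
    (hv₀ : ∀ i, v y₀ i = 1) (hv₀' : ∀ i, v' y₀ i = 1)
    (hw₀ : ∀ i, w z₀ i = 1) (hw₀' : ∀ i, w' z₀ i = 1)
    (h : ∀ x y z, ∑ i, a i * u x i * v y i * w z i = ∑ i, a' i * u' x i * v' y i * w' z i) :
    ∃ σ : Equiv.Perm ι, (∀ i, a i = a' (σ i)) ∧ (∀ x i, u x i = u' x (σ i)) ∧
      (∀ y i, v y i = v' y (σ i)) ∧ ∀ z i, w z i = w' z (σ i) := by
  choose cu hcu using exists_finsuppSum_eq_single hu
  choose cv hcv using exists_finsuppSum_eq_single hv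
  set U : Matrix ι ι ℝ := fun i k => (cu i).sum fun x r => r * u' x k with hU
  set V : Matrix ι ι ℝ := fun j k => (cv j).sum fun y r => r * v' y k with hV
  set Q : Matrix ι ι ℝ := fun k j => a' k * V j k / a j with hQ
  have contract_v : ∀ x z j, ∑ k, u' x k * w' z k * Q k j = u x j * w z j := by
    intro x z j
    have h1 := sum_mul_finsuppSum_congr (b := fun i => a i * u x i * w z i)
      (b' := fun i => a' i * u' x i * w' z i) (v := v) (v' := v')
      (fun y => by simpa only [mul_right_comm _ (w z _), mul_right_comm _ (w' z _)] using h x y z)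
      (cv j)
    simp only [hcv, mul_ite, mul_one, mul_zero, Finset.sum_ite_eq', Finset.mem_univ, if_true] at h1
    have h2 : ∑ k, u' x k * w' z k * Q k j = (∑ k, a' k * u' x k * w' z k * V j k) / a j := by
      rw [Finset.sum_div]
      exact Finset.sum_congr rfl fun k _ => by simp only [hQ]; ring
    rw [h2, ← h1]
    field_simp [ha j]
  have contract_u : ∀ y i, ∑ k, a' k * v' y k * U i k = a i * v y i := by
    intro y i
    have h1 := sum_mul_finsuppSum_congr (b := fun i => a i * v y i)
      (b' := fun i => a' i * v' y i) (v := u) (v' := u')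
      (fun x => by
        have := h x y z₀
        simp only [hw₀, hw₀', mul_one] at this
        simpa only [mul_right_comm _ (u x _), mul_right_comm _ (u' x _)] using this)
      (cu i)
    simp only [hcu, mul_ite, mul_one, mul_zero, Finset.sum_ite_eq', Finset.mem_univ, if_true] at h1
    exact h1.symm
  have hUDQ : ∀ z, U * (Matrix.diagonal (w' z) * Q) = Matrix.diagonal (w z) := by
    intro z
    ext i j
    have h1 := sum_mul_finsuppSum_congr (b := fun k => if k = j then w z k else 0)
      (b' := fun k => w' z k * Q k j) (v := u) (v' := u')
      (fun x => by
        simp only [ite_mul, zero_mul, Finset.sum_ite_eq', Finset.mem_univ, if_true]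
        rw [mul_comm, ← contract_v x z j]
        exact Finset.sum_congr rfl fun k _ => by ring)
      (cu i)
    simp only [hcu, ite_mul, zero_mul, Finset.sum_ite_eq', Finset.mem_univ, if_true] at h1
    rw [Matrix.mul_apply, Matrix.diagonal_apply]
    simp only [Matrix.diagonal_mul]
    rw [Finset.sum_congr rfl fun k _ => mul_comm _ _, ← h1]
    by_cases hij : i = j
    · subst hij; simp
    · simp [hij, Ne.symm hij]
  have hone : U * Q = 1 := by
    have := hUDQ z₀
    rwa [funext hw₀', funext hw₀, Matrix.diagonal_one, one_mul] at this
  have hQU : Q * U = 1 := mul_eq_one_comm.1 hone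
  have hcomm : ∀ z k j, w' z k * Q k j = Q k j * w z j := by
    intro z k j
    have : Matrix.diagonal (w' z) * Q = Q * Matrix.diagonal (w z) := by
      rw [← hUDQ z, ← mul_assoc, hQU, one_mul]
    simpa [Matrix.diagonal_mul, Matrix.mul_diagonal] using congrFun (congrFun this k) j
  have hne : ∀ z k j, Q k j ≠ 0 → w z j = w' z k := fun z k j hkj =>
    mul_left_cancel₀ hkj (by rw [← hcomm, mul_comm])
  have hsum : ∀ j, ∑ k, Q k j = 1 := by
    intro j
    simpa [hu₀, hu₀', hw₀, hw₀'] using contract_v x₀ z₀ j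
  have hex : ∀ j, ∃ k, Q k j ≠ 0 := by
    intro j
    by_contra! hall
    simpa [hall] using hsum j
  choose f hf using hex
  have hinj : Function.Injective f := fun j j' hjj =>
    hw j j' fun z => by rw [hne z _ _ (hf j), hne z _ _ (hf j'), hjj]
  let σ : Equiv.Perm ι := Equiv.ofBijective f (Finite.injective_iff_bijective.1 hinj)
  have hQ0 : ∀ k j, k ≠ f j → Q k j = 0 := by
    intro k j hkj
    by_contra hQkj
    obtain ⟨j', rfl⟩ := (Finite.injective_iff_surjective.1 hinj) k
    exact hkj (congrArg f (hw j' j fun z => by rw [hne z _ _ (hf j'), hne z _ _ hQkj]))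
  have hQ1 : ∀ j, Q (f j) j = 1 := by
    intro j
    rw [← hsum j, Finset.sum_eq_single (f j) (fun k _ hk => hQ0 k j hk) (by simp)]
  have hUf : ∀ i j, U i (f j) = if i = j then 1 else 0 := by
    intro i j
    have h1 := congrFun (congrFun hone i) j
    rw [Matrix.mul_apply, Finset.sum_eq_single (f j)
      (fun k _ hk => by rw [hQ0 k j hk, mul_zero]) (by simp), hQ1, mul_one] at h1
    rw [h1, Matrix.one_apply]
  have hv1 : ∀ y i, a' (f i) * v' y (f i) = a i * v y i := by
    intro y i
    rw [← contract_u y i, ← Equiv.sum_comp σ]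
    simp [σ, hUf]
  have ha1 : ∀ i, a i = a' (f i) := fun i => by simpa [hv₀, hv₀'] using (hv1 y₀ i).symm
  refine ⟨σ, ha1, fun x j => ?_, fun y i => ?_, fun z j => hne z _ _ (hf j)⟩
  · have h1 := contract_v x z₀ j
    rw [Finset.sum_eq_single (f j) (fun k _ hk => by rw [hQ0 k j hk, mul_zero]) (by simp), hQ1,
      hw₀, hw₀', mul_one, mul_one, mul_one] at h1
    exact h1.symm
  · refine mul_left_cancel₀ (ha i) ?_
    rw [← hv1, ← ha1]
    rfl

/-! ### Triangular blocks are linearly independent -/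

/-- The product functions of a triangular family are linearly independent in `h`: the factor number
`i` depends only on the coordinates `c 0, …, c i` and separates any two configurations that differ
at `c i`. The induction fixes one more of these coordinates at each step. -/
lemma eq_zero_of_triangular {J K : ℕ} {α : Fin J → Type*} (q : ∀ j, α j → (Fin K → Bool) → ℝ)
    (one : ∀ j, α j) (hone : ∀ j h, q j (one j) h = 1) (e : Fin K ↪ Fin J)
    (c : Equiv.Perm (Fin K))
    (hdep : ∀ i A h h', (∀ l ≤ i, h (c l) = h' (c l)) → q (e i) A h = q (e i) A h')
    (hsep : ∀ i h h', h (c i) ≠ h' (c i) → ∃ A, q (e i) A h ≠ q (e i) A h')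
    {a : (Fin K → Bool) → ℝ} (ha : ∀ A : ∀ j, α j, ∑ h, a h * ∏ i, q (e i) (A (e i)) h = 0) :
    a = 0 := by
  have key : ∀ m : ℕ, m ≤ K → ∀ (g : Fin K → Bool) (A : ∀ j, α j),
      ∑ h with ∀ l : Fin K, (l : ℕ) < m → h (c l) = g (c l),
        a h * ∏ i ∈ Finset.univ.filter (fun i : Fin K => m ≤ (i : ℕ)), q (e i) (A (e i)) h = 0 := by
    intro m
    induction m with
    | zero => intro _ g A; simpa using ha A
    | succ m ih =>
      intro hm g A
      set i₀ : Fin K := ⟨m, hm⟩ with hi₀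
      -- `S b` collects the configurations that extend the prefix of `g` by the value `b`.
      set F : (Fin K → Bool) → ℝ :=
        fun h => a h * ∏ i ∈ Finset.univ.filter (fun i : Fin K => m + 1 ≤ (i : ℕ)),
          q (e i) (A (e i)) h with hF
      set gb : Bool → Fin K → Bool := fun b => Function.update g (c i₀) b with hgb
      set S : Bool → ℝ := fun b =>
        ∑ h with ∀ l : Fin K, (l : ℕ) < m + 1 → h (c l) = gb b (c l), F h with hS
      have hgbl : ∀ b (l : Fin K), (l : ℕ) < m → gb b (c l) = g (c l) := by
        intro b l hl
        refine Function.update_of_ne (fun hcl => ?_) _ _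
        rw [c.injective hcl] at hl
        exact lt_irrefl _ hl
      have hext : ∀ b (h : Fin K → Bool),
          (∀ l : Fin K, (l : ℕ) < m + 1 → h (c l) = gb b (c l)) ↔
            (∀ l : Fin K, (l : ℕ) < m → h (c l) = g (c l)) ∧ h (c i₀) = b := by
        intro b h
        constructor
        · intro hh
          refine ⟨fun l hl => by rw [hh l (by omega), hgbl b l hl], ?_⟩
          rw [hh i₀ (by simp [hi₀])]
          simp [hgb]
        · rintro ⟨h1, h2⟩ l hl
          rcases Nat.lt_succ_iff_lt_or_eq.1 hl with hl | hl
          · rw [h1 l hl, hgbl b l hl]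
          · have : l = i₀ := Fin.ext hl
            rw [this, h2]
            simp [hgb]
      have hrel : ∀ E : α (e i₀), q (e i₀) E (gb true) * S true + q (e i₀) E (gb false) * S false
          = 0 := by
        intro E
        have h0 := ih (by omega) g (Function.update A (e i₀) E)
        have hprod : ∀ h, ∏ i ∈ Finset.univ.filter (fun i : Fin K => m ≤ (i : ℕ)),
            q (e i) (Function.update A (e i₀) E (e i)) h =
            q (e i₀) E h * ∏ i ∈ Finset.univ.filter (fun i : Fin K => m + 1 ≤ (i : ℕ)),
              q (e i) (A (e i)) h := by
          intro h
          have hins : (Finset.univ.filter fun i : Fin K => m ≤ (i : ℕ)) =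
              insert i₀ (Finset.univ.filter fun i : Fin K => m + 1 ≤ (i : ℕ)) := by
            ext i
            simp only [Finset.mem_filter, Finset.mem_univ, true_and, Finset.mem_insert, Fin.ext_iff,
              hi₀]
            omega
          rw [hins, Finset.prod_insert (by simp [hi₀]), Function.update_self]
          congr 1
          refine Finset.prod_congr rfl fun i hi => ?_
          rw [Function.update_of_ne]
          intro hei
          rw [e.injective hei] at hi
          simp [hi₀] at hi
        rw [← h0, ← Finset.sum_filter_add_sum_filter_not _ (fun h => h (c i₀) = true)]
        simp only [Finset.filter_filter, Bool.not_eq_true, ← hext, hS, Finset.mul_sum]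
        congr 1 <;>
        · refine Finset.sum_congr rfl fun h hh => ?_
          simp only [Finset.mem_filter, Finset.mem_univ, true_and] at hh
          rw [hprod, hdep i₀ E h _ fun l hl => hh l (Nat.lt_succ_of_le hl)]
          simp only [hF]
          ring
      -- The trivial event and a separating one give two independent equations for the two sums.
      have hS0 : S true = 0 ∧ S false = 0 := by
        obtain ⟨E, hE⟩ := hsep i₀ (gb true) (gb false) (by simp [hgb])
        have h1 := hrel (one _)
        have h2 := hrel E
        rw [hone, hone] at h1
        have h3 : (q (e i₀) E (gb true) - q (e i₀) E (gb false)) * S true = 0 := by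
          linear_combination h2 - q (e i₀) E (gb false) * h1
        have h4 := (mul_eq_zero.1 h3).resolve_left (sub_ne_zero.2 hE)
        exact ⟨h4, by linarith⟩
      have hg : gb (g (c i₀)) = g := by simp [hgb]
      have : S (g (c i₀)) = 0 := by
        cases g (c i₀)
        exacts [hS0.2, hS0.1]
      simpa only [hS, hg] using this
  ext g
  have h1 := key K le_rfl g one
  rw [Finset.sum_eq_single g] at h1
  · simpa [hone] using h1
  · intro h hh hne
    refine absurd (funext fun k => ?_) hne
    have := (Finset.mem_filter.1 hh).2 (c.symm k) (c.symm k).2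
    simpa using this
  · intro hg
    exact absurd (Finset.mem_filter.2 ⟨Finset.mem_univ _, fun _ _ => rfl⟩) hg

/-! ### Recovering the bipartite matrix and the labels -/

lemma card_filter_agree {K : ℕ} (N : Finset (Fin K)) (g : Fin K → Bool) :
    (Finset.univ.filter fun h : Fin K → Bool => ∀ k ∈ N, h k = g k).card = 2 ^ Nᶜ.card := by
  have : (Finset.univ.filter fun h : Fin K → Bool => ∀ k ∈ N, h k = g k) =
      Fintype.piFinset fun k => if k ∈ N then {g k} else Finset.univ := by
    ext h
    simp only [Finset.mem_filter, Finset.mem_univ, true_and, Fintype.mem_piFinset]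
    refine forall_congr' fun k => ?_
    by_cases hk : k ∈ N <;> simp [hk]
  rw [this, Fintype.card_piFinset]
  have h2 : ∀ k, (if k ∈ N then {g k} else (Finset.univ : Finset Bool)).card =
      if k ∈ N then 1 else 2 := by
    intro k
    split_ifs <;> simp
  simp only [h2, Finset.prod_ite, Finset.prod_const_one, one_mul, Finset.prod_const]
  congr 2
  ext k
  simp

/-- Two finite families of sets with equally many members below each set agree up to a
permutation. -/
lemma exists_perm_of_card_subset_eq {J K : ℕ} (s s' : Fin K → Finset (Fin J))
    (h : ∀ T, (Finset.univ.filter fun k => s k ⊆ T).card =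
      (Finset.univ.filter fun k => s' k ⊆ T).card) :
    ∃ σ : Equiv.Perm (Fin K), ∀ k, s' (σ k) = s k := by
  have hfib : ∀ (s : Fin K → Finset (Fin J)) T, (Finset.univ.filter fun k => s k ⊆ T).card =
      (Finset.univ.filter fun k => s k = T).card +
        ∑ T' ∈ T.ssubsets, (Finset.univ.filter fun k => s k = T').card := by
    intro s T
    rw [Finset.card_eq_sum_card_fiberwise (f := s) (t := T.powerset)
      (fun k hk => by simpa using hk), ← Finset.add_sum_erase _ _ (Finset.mem_powerset_self T)]
    have : ∀ T' ⊆ T, ((Finset.univ.filter fun k => s k ⊆ T).filter fun k => s k = T') =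
        Finset.univ.filter fun k => s k = T' := by
      intro T' hT'
      ext k
      simp only [Finset.mem_filter, Finset.mem_univ, true_and, and_iff_right_iff_imp]
      rintro rfl
      exact hT'
    rw [this T subset_rfl]
    congr 1
    refine Finset.sum_congr rfl fun T' hT' => by rw [this T' (Finset.mem_ssubsets.1 hT').subset]
  have hcard : ∀ T, (Finset.univ.filter fun k => s k = T).card =
      (Finset.univ.filter fun k => s' k = T).card := by
    intro T
    induction T using Finset.strongInduction with
    | H T ih =>
      have h1 := h T
      rw [hfib, hfib,
        Finset.sum_congr rfl fun T' hT' => ih T' (Finset.mem_ssubsets.1 hT')] at h1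
      exact Nat.add_right_cancel h1
  have hequiv : ∀ T, Nonempty ({k // s k = T} ≃ {k // s' k = T}) := fun T => by
    rw [← Fintype.card_eq, Fintype.card_subtype, Fintype.card_subtype, hcard]
  exact ⟨Equiv.ofFiberEquiv fun T => (hequiv T).some, fun k => Equiv.ofFiberEquiv_map _ k⟩

section Cube

variable {J K : ℕ} {Γ Γ' : Matrix (Fin J) (Fin K) Bool} {R : Equiv.Perm (Fin K → Bool)}

/-- If a bijection of the cube matches, for every row, the partitions according to the coordinates
in the row, then the two matrices agree up to a permutation of columns: the sizes of the cells of
the common refinements determine how many columns are supported in each set of rows. -/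
lemma exists_perm_columns
    (hR : ∀ j h h', (∀ k, Γ j k = true → h k = h' k) ↔ ∀ k, Γ' j k = true → R h k = R h' k) :
    ∃ σ : Equiv.Perm (Fin K), ∀ j k, Γ j k = Γ' j (σ k) := by
  obtain ⟨σ, hσ⟩ := exists_perm_of_card_subset_eq
    (fun k => Finset.univ.filter fun j => Γ j k = true)
    (fun k => Finset.univ.filter fun j => Γ' j k = true) (fun T => by
      have hN : ∀ Γ : Matrix (Fin J) (Fin K) Bool,
          (Finset.univ.filter fun k => (Finset.univ.filter fun j => Γ j k = true) ⊆ T) =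
          (Finset.univ.filter fun k => ∃ j ∉ T, Γ j k = true)ᶜ := by
        intro Γ
        ext k
        simp only [Finset.mem_filter, Finset.mem_univ, true_and, Finset.mem_compl,
          Finset.subset_iff]
        push Not
        exact forall_congr' fun j => by tauto
      rw [hN, hN]
      refine Nat.pow_right_injective le_rfl ?_
      simp only
      rw [← card_filter_agree _ (fun _ => true), ← card_filter_agree _ (R fun _ => true)]
      refine Finset.card_bij (fun h _ => R h) ?_ (fun _ _ _ _ hh => R.injective hh) ?_
      · intro h hh
        simp only [Finset.mem_filter, Finset.mem_univ, true_and] at hh ⊢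
        rintro k ⟨j, hj, hjk⟩
        exact (hR j _ _).1 (fun k hk => hh k ⟨j, hj, hk⟩) k hjk
      · intro h hh
        simp only [Finset.mem_filter, Finset.mem_univ, true_and] at hh
        refine ⟨R.symm h, ?_, R.apply_symm_apply h⟩
        simp only [Finset.mem_filter, Finset.mem_univ, true_and]
        rintro k ⟨j, hj, hjk⟩
        refine (hR j (R.symm h) fun _ => true).2 (fun k hk => ?_) k hjk
        rw [R.apply_symm_apply]
        exact hh k ⟨j, hj, hk⟩)
  refine ⟨σ, fun j k => ?_⟩
  have := Finset.ext_iff.1 (hσ k) j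
  simp only [Finset.mem_filter, Finset.mem_univ, true_and] at this
  exact Bool.eq_iff_iff.2 this.symm

/-- A map of the cube that sends each edge of direction `l` into a line of direction `σ l` acts
coordinatewise. -/
lemma apply_eq_of_agree_off {σ : Equiv.Perm (Fin K)} {f : (Fin K → Bool) → Fin K → Bool}
    (hf : ∀ l h h', (∀ m, m ≠ l → h m = h' m) → ∀ m, m ≠ σ l → f h m = f h' m)
    {k : Fin K} {h h' : Fin K → Bool} (hk : h k = h' k) : f h (σ k) = f h' (σ k) := by
  have key : ∀ F : Finset (Fin K), k ∉ F → f (F.piecewise h' h) (σ k) = f h (σ k) := by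
    intro F
    induction F using Finset.induction_on with
    | empty => intro _; simp
    | insert l F _ ih =>
      intro hkF
      rw [Finset.mem_insert, not_or] at hkF
      rw [Finset.piecewise_insert, ← ih hkF.2]
      exact hf l _ _ (fun m hm => Function.update_of_ne hm _ _) _ (σ.injective.ne hkF.1)
  rw [← key (Finset.univ.erase k) (by simp)]
  congr 2
  ext m
  by_cases hm : m = k
  · subst hm; simp [hk]
  · simp [hm]

lemma agree_off_iff (hsub : SubsetCondition Γ) {σ : Equiv.Perm (Fin K)}
    (hσ : ∀ j k, Γ j k = Γ' j (σ k))
    (hR : ∀ j h h', (∀ k, Γ j k = true → h k = h' k) ↔ ∀ k, Γ' j k = true → R h k = R h' k)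
    (l : Fin K) (h h' : Fin K → Bool) :
    (∀ m, m ≠ l → h m = h' m) ↔ ∀ m, m ≠ σ l → R h m = R h' m := by
  have hrow : ∀ m, m ≠ l → ∃ j, Γ j m = true ∧ ¬ Γ j l = true := fun m hm => by
    simpa [Set.subset_def] using hsub m l hm
  constructor
  · intro hh m hm
    obtain ⟨j, hj, hjl⟩ := hrow (σ.symm m) (fun hml => hm (by rw [← hml, σ.apply_symm_apply]))
    refine (hR j h h').1 (fun k hk => hh k ?_) m (by rw [← hj, hσ, σ.apply_symm_apply])
    rintro rfl
    exact hjl hk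
  · intro hh m hm
    obtain ⟨j, hj, hjl⟩ := hrow m hm
    refine (hR j h h').2 (fun k hk => hh k ?_) m hj
    rintro rfl
    exact hjl (by rw [hσ, hk])

/-- Under the subset condition the bijection matches the coordinates, since the observed variables
that are not children of `l` have all the other latent variables as parents. -/
lemma apply_eq_iff (hsub : SubsetCondition Γ) {σ : Equiv.Perm (Fin K)}
    (hσ : ∀ j k, Γ j k = Γ' j (σ k))
    (hR : ∀ j h h', (∀ k, Γ j k = true → h k = h' k) ↔ ∀ k, Γ' j k = true → R h k = R h' k)
    (k : Fin K) (h h' : Fin K → Bool) : R h (σ k) = R h' (σ k) ↔ h k = h' k := by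
  have hoff := agree_off_iff hsub hσ hR
  refine ⟨fun hk => ?_, fun hk => apply_eq_of_agree_off (fun l h h' => (hoff l h h').1) hk⟩
  have := apply_eq_of_agree_off (σ := σ.symm) (f := R.symm) (fun l h h' hl => by
    have := (hoff (σ.symm l) (R.symm h) (R.symm h')).2
    simp only [σ.apply_symm_apply, R.apply_symm_apply] at this
    exact this hl) hk
  simpa using this

lemma exists_relabel_eq {σ : Equiv.Perm (Fin K)}
    (hR : ∀ k h h', R h (σ k) = R h' (σ k) ↔ h k = h' k) :
    ∃ τ : Fin K → Equiv.Perm Bool, ∀ h, R h = relabel σ τ h := by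
  have hinj : ∀ k, Function.Injective fun b : Bool => R (fun _ => b) (σ k) :=
    fun k b b' hb => (hR k _ _).1 hb
  refine ⟨fun k => Equiv.ofBijective _ (Finite.injective_iff_bijective.1 (hinj k)), fun h => ?_⟩
  ext m : 1
  have := (hR (σ.symm m) h fun _ => h (σ.symm m)).2 rfl
  simpa [relabel] using this

end Cube

/-! ### d-separation of latent variables -/

section DSeparation

variable {J K : ℕ} {G : Digraph (Fin K ⊕ Fin J)}

lemma reflTransGen_inl_iff (hG : ∀ (j : Fin J) v, ¬ G.Adj (Sum.inr j) v) {k l : Fin K} :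
    Relation.ReflTransGen G.Adj (Sum.inl k) (Sum.inl l) ↔
      Relation.ReflTransGen (latentGraph G).Adj k l := by
  constructor
  · intro h
    have key : ∀ v, Relation.ReflTransGen G.Adj (Sum.inl k) v → ∀ l, v = Sum.inl l →
        Relation.ReflTransGen (latentGraph G).Adj k l := by
      intro v hv
      induction hv with
      | refl => rintro l hl; rw [Sum.inl.inj hl]
      | @tail b c _ hbc ih =>
        rintro l rfl
        cases b with
        | inl m => exact (ih m rfl).tail hbc
        | inr j => exact absurd hbc (hG j _)
    exact key _ h l rfl
  · exact fun h => h.lift Sum.inl fun _ _ hab => hab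

/-- Observed variables are childless, so an active path given latent variables cannot pass through
them: an observed interior vertex would be a collider without descendants in the conditioning
set. -/
lemma dSep_inl_iff (hG : ∀ (j : Fin J) v, ¬ G.Adj (Sum.inr j) v) (A B C : Set (Fin K)) :
    DSep G (Sum.inl '' A) (Sum.inl '' B) (Sum.inl '' C) ↔ DSep (latentGraph G) A B C := by
  have hinl : ∀ q : ℕ → Fin K, ∀ n, IsActivePath G (Sum.inl '' C) n (fun i => Sum.inl (q i)) ↔
      IsActivePath (latentGraph G) C n q := by
    intro q n
    have hdesc : ∀ k : Fin K,
        (∃ c ∈ (Sum.inl '' C : Set (Fin K ⊕ Fin J)), Relation.ReflTransGen G.Adj (Sum.inl k) c) ↔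
          ∃ c ∈ C, Relation.ReflTransGen (latentGraph G).Adj k c := by
      intro k
      rw [Set.exists_mem_image]
      simp only [reflTransGen_inl_iff hG]
    constructor
    · rintro ⟨h1, h2, h3, h4⟩
      exact ⟨fun i hi i' hi' h => h1 hi hi' (congrArg Sum.inl h), h2,
        fun i hi h => (hdesc _).1 (h3 i hi h),
        fun i hi h hC => h4 i hi h (Set.mem_image_of_mem _ hC)⟩
    · rintro ⟨h1, h2, h3, h4⟩
      exact ⟨fun i hi i' hi' h => h1 hi hi' (Sum.inl.inj h), h2,
        fun i hi h => (hdesc _).2 (h3 i hi h),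
        fun i hi h hC => h4 i hi h (Sum.inl_injective.mem_set_image.1 hC)⟩
  constructor
  · rintro h a ha b hb ⟨n, q, rfl, rfl, hq⟩
    exact h _ (Set.mem_image_of_mem _ ha) _ (Set.mem_image_of_mem _ hb)
      ⟨n, fun i => Sum.inl (q i), rfl, rfl, (hinl q n).2 hq⟩
  · rintro h _ ⟨a, ha, rfl⟩ _ ⟨b, hb, rfl⟩ ⟨n, p, hp0, hpn, hp⟩
    have hlat : ∀ i ≤ n, ∃ k, p i = Sum.inl k := by
      intro i hi
      cases hpi : p i with
      | inl k => exact ⟨k, rfl⟩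
      | inr j =>
        exfalso
        obtain ⟨i, rfl⟩ : ∃ i', i = i' + 1 := Nat.exists_eq_succ_of_ne_zero (by
          rintro rfl
          rw [hp0] at hpi
          cases hpi)
        have hin : i + 1 ≠ n := by
          intro hin
          rw [hin, hpn] at hpi
          cases hpi
        have h1 := (hp.adj i (by omega)).resolve_right (by rw [hpi]; exact hG j _)
        have h2 := (hp.adj (i + 1) (by omega)).resolve_left (by rw [hpi]; exact hG j _)
        obtain ⟨_, ⟨c, -, rfl⟩, hdesc⟩ := hp.collider i (by omega) ⟨h1, h2⟩
        rw [hpi] at hdesc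
        rcases Relation.ReflTransGen.cases_head hdesc with h | ⟨_, h, -⟩
        · cases h
        · exact hG j _ h
    -- Beyond the last vertex of the path the values are irrelevant.
    have hmin : ∃ q : ℕ → Fin K, ∀ i, Sum.inl (q i) = p (min i n) := by
      choose q hq using fun i => hlat (min i n) (min_le_right _ _)
      exact ⟨q, fun i => (hq i).symm⟩
    obtain ⟨q, hq⟩ := hmin
    have hqp : ∀ i ≤ n, (Sum.inl (q i) : Fin K ⊕ Fin J) = p i := fun i hi => by
      rw [hq, min_eq_left hi]
    refine h a ha b hb ⟨n, q, ?_, ?_, (hinl q n).1 ⟨?_, ?_, ?_, ?_⟩⟩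
    · exact Sum.inl.inj ((hqp 0 (Nat.zero_le _)).trans hp0)
    · exact Sum.inl.inj ((hqp n le_rfl).trans hpn)
    · intro i hi i' hi' hii
      simp only [hqp i hi, hqp i' hi'] at hii
      exact hp.injOn hi hi' hii
    · intro i hi
      simp only [hqp i hi.le, hqp (i + 1) hi]
      exact hp.adj i hi
    · intro i hi
      simp only [hqp i (by omega), hqp (i + 1) (by omega), hqp (i + 2) hi]
      exact hp.collider i hi
    · intro i hi
      simp only [hqp i (by omega), hqp (i + 1) (by omega), hqp (i + 2) hi]
      exact hp.nonCollider i hi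

end DSeparation

/-! ### Conditional independence of latent variables -/

section ConditionalIndependence

variable {J K : ℕ} {X : Fin J → Type*} [∀ j, MeasurableSpace (X j)]

/-- `S` is a set of latent configurations whose membership is decided by the coordinates in `A`. -/
def DependsOnly (A : Set (Fin K)) (S : Set (Fin K → Bool)) : Prop :=
  ∀ h h', (∀ k ∈ A, h k = h' k) → (h ∈ S ↔ h' ∈ S)

lemma sigmaOf_inl (A : Set (Fin K)) :
    sigmaOf X (Sum.inl '' A) =
      MeasurableSpace.comap (fun (ω : Outcome K X) (k : A) => ω.1 k) inferInstance := by
  rw [sigmaOf, iSup_image, iSup_subtype']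
  simp only [MeasurableSpace.pi, MeasurableSpace.comap_iSup, MeasurableSpace.comap_comp]
  rfl

lemma sigmaOf_inl_le (A : Set (Fin K)) :
    sigmaOf X (Sum.inl '' A) ≤ (inferInstance : MeasurableSpace (Outcome K X)) := by
  rw [sigmaOf_inl]
  exact Measurable.comap_le (by fun_prop)

lemma measurableSet_sigmaOf_inl_iff {A : Set (Fin K)} {s : Set (Outcome K X)} :
    MeasurableSet[sigmaOf X (Sum.inl '' A)] s ↔
      ∃ S : Set (Fin K → Bool), DependsOnly A S ∧ Prod.fst ⁻¹' S = s := by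
  rw [sigmaOf_inl]
  constructor
  · rintro ⟨T, -, rfl⟩
    refine ⟨(fun h (k : A) => h k) ⁻¹' T, fun h h' hh => ?_, rfl⟩
    have : (fun k : A => h k) = fun k : A => h' k := funext fun k => hh k k.2
    simp only [Set.mem_preimage, this]
  · rintro ⟨S, hS, rfl⟩
    refine ⟨(fun h (k : A) => h k) '' S, (Set.toFinite _).measurableSet, ?_⟩
    ext ω
    simp only [Set.mem_preimage, Set.mem_image]
    refine ⟨?_, fun h => ⟨_, h, rfl⟩⟩
    rintro ⟨h, hhS, hh⟩
    exact (hS h ω.1 fun k hk => congrFun hh ⟨k, hk⟩).1 hhS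

/-- Conditional probabilities given finitely many binary variables are ratios; the equality holds
everywhere because a version that is measurable with respect to these variables is constant on the
atoms. -/
lemma condExp_sigmaOf_inl {P : Measure (Outcome K X)} [IsProbabilityMeasure P]
    {C : Set (Fin K)} {ω : Outcome K X} (hpos : P (latentEvent X C ω.1) ≠ 0)
    {s : Set (Outcome K X)} (hs : MeasurableSet s) :
    (P⟦s | sigmaOf X (Sum.inl '' C)⟧) ω =
      P.real (s ∩ latentEvent X C ω.1) / P.real (latentEvent X C ω.1) := by
  set E := latentEvent X C ω.1 with hE
  set f := P⟦s | sigmaOf X (Sum.inl '' C)⟧ with hf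
  have hEm : MeasurableSet[sigmaOf X (Sum.inl '' C)] E :=
    measurableSet_sigmaOf_inl_iff.2 ⟨{h | ∀ k ∈ C, h k = ω.1 k},
      fun h h' hh => forall₂_congr fun k hk => by rw [hh k hk], rfl⟩
  have hconst : ∀ ω' ∈ E, f ω' = f ω := by
    intro ω' hω'
    have hfm : Measurable[sigmaOf X (Sum.inl '' C)] f := stronglyMeasurable_condExp.measurable
    rw [sigmaOf_inl] at hfm
    exact hfm.factorsThrough (funext fun k : C => hω' k k.2)
  have h1 : ∫ x in E, f x ∂P = f ω * P.real E := by
    rw [setIntegral_congr_fun (sigmaOf_inl_le C _ hEm) hconst, setIntegral_const, smul_eq_mul,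
      mul_comm]
  have h2 : ∫ x in E, f x ∂P = P.real (s ∩ E) := by
    rw [hf, setIntegral_condExp (sigmaOf_inl_le C)
      ((integrable_const (1 : ℝ)).indicator hs) hEm, integral_indicator hs, setIntegral_const,
      smul_eq_mul, mul_one, measureReal_restrict_apply' (sigmaOf_inl_le C _ hEm)]
  have hne : P.real E ≠ 0 := (measureReal_ne_zero_iff).2 hpos
  rw [← h2, h1, mul_div_cancel_right₀ _ hne]

lemma condIndep_inl_iff {P : Measure (Outcome K X)} [IsProbabilityMeasure P]
    (hpos : ∀ h, 0 < proportion P h) (A B C : Set (Fin K)) :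
    CondIndep P (Sum.inl '' A) (Sum.inl '' B) (Sum.inl '' C) ↔
      ∀ S T : Set (Fin K → Bool), DependsOnly A S → DependsOnly B T → ∀ g : Fin K → Bool,
        P.real (Prod.fst ⁻¹' (S ∩ T ∩ {h | ∀ k ∈ C, h k = g k})) /
            P.real (Prod.fst ⁻¹' {h | ∀ k ∈ C, h k = g k}) =
          P.real (Prod.fst ⁻¹' (S ∩ {h | ∀ k ∈ C, h k = g k})) /
              P.real (Prod.fst ⁻¹' {h | ∀ k ∈ C, h k = g k}) *
            (P.real (Prod.fst ⁻¹' (T ∩ {h | ∀ k ∈ C, h k = g k})) /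
              P.real (Prod.fst ⁻¹' {h | ∀ k ∈ C, h k = g k})) := by
  have hE : ∀ g, P (latentEvent X C g) ≠ 0 := fun g hg =>
    (hpos g).ne' (measure_mono_null (by intro ω hω k _; exact hω k trivial) hg)
  have hmeas : ∀ S : Set (Fin K → Bool), MeasurableSet (Prod.fst ⁻¹' S : Set (Outcome K X)) :=
    fun S => measurable_fst (Set.toFinite S).measurableSet
  have hval : ∀ (S : Set (Fin K → Bool)) ω,
      (P⟦(Prod.fst ⁻¹' S : Set (Outcome K X)) | sigmaOf X (Sum.inl '' C)⟧) ω =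
        P.real (Prod.fst ⁻¹' (S ∩ {h | ∀ k ∈ C, h k = ω.1 k})) /
          P.real (Prod.fst ⁻¹' {h | ∀ k ∈ C, h k = ω.1 k}) := fun S ω => by
    rw [condExp_sigmaOf_inl (hE ω.1) (hmeas S)]
    rfl
  constructor
  · intro h S T hS hT g
    have hae := h _ _ (measurableSet_sigmaOf_inl_iff.2 ⟨S, hS, rfl⟩)
      (measurableSet_sigmaOf_inl_iff.2 ⟨T, hT, rfl⟩)
    obtain ⟨ω, hω, hg⟩ : ∃ ω : Outcome K X, ω ∈ latentEvent X Set.univ g ∧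
        (P⟦(Prod.fst ⁻¹' S ∩ Prod.fst ⁻¹' T : Set (Outcome K X)) | sigmaOf X (Sum.inl '' C)⟧) ω =
          (P⟦(Prod.fst ⁻¹' S : Set (Outcome K X)) | sigmaOf X (Sum.inl '' C)⟧ *
            P⟦(Prod.fst ⁻¹' T : Set (Outcome K X)) | sigmaOf X (Sum.inl '' C)⟧) ω := by
      by_contra! hall
      refine (hpos g).ne' (measure_mono_null ?_ hae)
      intro ω hω
      exact hall ω hω
    obtain rfl : ω.1 = g := funext fun k => hω k trivial
    rw [← Set.preimage_inter, Pi.mul_apply, hval, hval, hval] at hg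
    exact hg
  · intro h s t hs ht
    obtain ⟨S, hS, rfl⟩ := measurableSet_sigmaOf_inl_iff.1 hs
    obtain ⟨T, hT, rfl⟩ := measurableSet_sigmaOf_inl_iff.1 ht
    refine Filter.Eventually.of_forall fun ω => ?_
    rw [← Set.preimage_inter, Pi.mul_apply, hval, hval, hval]
    exact h S T hS hT ω.1

/-- A bijection of the cube that matches the latent proportions and the coordinates transports
conditional independence. -/
lemma CondIndep.of_relabel {P P' : Measure (Outcome K X)} [IsProbabilityMeasure P]
    [IsProbabilityMeasure P'] (hpos : ∀ h, 0 < proportion P h) (hpos' : ∀ h, 0 < proportion P' h)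
    {R : Equiv.Perm (Fin K → Bool)} {σ : Equiv.Perm (Fin K)}
    (hπ : ∀ h, proportion P h = proportion P' (R h))
    (hR : ∀ k h h', R h (σ k) = R h' (σ k) ↔ h k = h' k) {A B C : Set (Fin K)}
    (hCI : CondIndep P (Sum.inl '' A) (Sum.inl '' B) (Sum.inl '' C)) :
    CondIndep P' (Sum.inl '' (σ '' A)) (Sum.inl '' (σ '' B)) (Sum.inl '' (σ '' C)) := by
  rw [condIndep_inl_iff hpos] at hCI
  rw [condIndep_inl_iff hpos']
  have hmap : (P.map Prod.fst).map R = P'.map Prod.fst := by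
    refine Measure.ext_of_singleton fun h => ?_
    have hsing : ∀ (Q : Measure (Outcome K X)) g, Q.map Prod.fst {g} = proportion Q g := by
      intro Q g
      rw [Measure.map_apply measurable_fst (measurableSet_singleton _), proportion]
      congr 1
      ext ω
      simp [latentEvent, funext_iff]
    rw [Measure.map_apply (measurable_of_finite _) (measurableSet_singleton _), hsing]
    have : R ⁻¹' {h} = {R.symm h} := by
      ext g
      simp [Equiv.eq_symm_apply]
    rw [this, hsing, hπ, R.apply_symm_apply]
  have hreal : ∀ S : Set (Fin K → Bool), P'.real (Prod.fst ⁻¹' S) =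
      P.real (Prod.fst ⁻¹' (R ⁻¹' S)) := by
    intro S
    have hS : MeasurableSet S := (Set.toFinite S).measurableSet
    have hS' : MeasurableSet (R ⁻¹' S) := (Set.toFinite _).measurableSet
    rw [Measure.real, Measure.real, ← Measure.map_apply measurable_fst hS, ← hmap,
      Measure.map_apply (measurable_of_finite _) hS, Measure.map_apply measurable_fst hS']
  have hdep : ∀ {A S}, DependsOnly (σ '' A) S → DependsOnly A (R ⁻¹' S) := by
    intro A S hS h h' hh
    refine hS _ _ ?_
    rintro _ ⟨k, hk, rfl⟩
    exact (hR k h h').2 (hh k hk)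
  intro S T hS hT g
  have hC : R ⁻¹' {h | ∀ k ∈ σ '' C, h k = g k} = {h | ∀ k ∈ C, h k = R.symm g k} := by
    ext h
    simp only [Set.mem_preimage, Set.mem_ofPred_eq, Set.forall_mem_image]
    refine forall₂_congr fun k _ => ?_
    rw [← hR k h, R.apply_symm_apply]
  simp only [hreal, Set.preimage_inter (f := R), hC]
  exact hCI _ _ (hdep hS) (hdep hT) (R.symm g)

end ConditionalIndependence

/-! ### The observed distribution as a mixture of product measures -/

lemma latentEvent_congr {J K : ℕ} {X : Fin J → Type*} {S : Set (Fin K)} {h h' : Fin K → Bool}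
    (hh : ∀ k ∈ S, h k = h' k) : latentEvent X S h = latentEvent X S h' := by
  ext ω
  exact forall₂_congr fun k hk => by rw [hh k hk]

section Mixture

variable {J K : ℕ} {X : Fin J → Type*} [∀ j, MeasurableSpace (X j)]
  {G : Digraph (Fin K ⊕ Fin J)} {P : Measure (Outcome K X)}

lemma measurableSet_latentEvent (S : Set (Fin K)) (h : Fin K → Bool) :
    MeasurableSet (latentEvent X S h) :=
  measurable_fst (Set.toFinite {g : Fin K → Bool | ∀ k ∈ S, g k = h k}).measurableSet

lemma IsBLCM.latentEvent_ne_zero (hP : IsBLCM G P) (S : Set (Fin K)) (h : Fin K → Bool) :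
    P (latentEvent X S h) ≠ 0 := fun h0 =>
  (hP.proportion_pos h).ne' (measure_mono_null (by intro ω hω k _; exact hω k trivial) h0)

lemma IsBLCM.isProbabilityMeasure_condLaw (hP : IsBLCM G P) (j : Fin J) (S : Set (Fin K))
    (h : Fin K → Bool) : IsProbabilityMeasure (condLaw P j S h) := by
  have := hP.isProbabilityMeasure
  have := ProbabilityTheory.cond_isProbabilityMeasure (hP.latentEvent_ne_zero S h)
  exact Measure.isProbabilityMeasure_map (by fun_prop)

lemma IsBLCM.isProbabilityMeasure_obsLaw (hP : IsBLCM G P) (j : Fin J) (h : Fin K → Bool) :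
    IsProbabilityMeasure (obsLaw P j h) :=
  hP.isProbabilityMeasure_condLaw j _ h

lemma IsBLCM.measure_rect (hP : IsBLCM G P) (h : Fin K → Bool) {A : ∀ j, Set (X j)}
    (hA : ∀ j, MeasurableSet (A j)) :
    P {ω | ω.1 = h ∧ ∀ j, ω.2 j ∈ A j} =
      proportion P h * ∏ j, condLaw P j (latentParents G (Sum.inr j)) h (A j) := by
  have hprob := fun j => hP.isProbabilityMeasure_condLaw j (latentParents G (Sum.inr j)) h
  have h1 := hP.markov h (fun _ => Set.univ) fun _ => MeasurableSet.univ
  have h2 : {ω : Outcome K X | ω.1 = h ∧ ∀ j, ω.2 j ∈ (Set.univ : Set (X j))} =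
      latentEvent X Set.univ h := by
    ext ω
    simp [latentEvent, funext_iff]
  rw [h2] at h1
  simp only [measure_univ, Finset.prod_const_one, mul_one] at h1
  rw [hP.markov h A hA, proportion, h1]

lemma IsBLCM.obsLaw_eq_condLaw (hP : IsBLCM G P) (j : Fin J) (h : Fin K → Bool) :
    obsLaw P j h = condLaw P j (latentParents G (Sum.inr j)) h := by
  have := hP.isProbabilityMeasure
  have hprob := fun j => hP.isProbabilityMeasure_condLaw j (latentParents G (Sum.inr j)) h
  ext A hA
  have hm : Measurable fun ω : Outcome K X => ω.2 j := by fun_prop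
  rw [obsLaw, condLaw, Measure.map_apply hm hA,
    ProbabilityTheory.cond_apply (measurableSet_latentEvent _ _)]
  have h1 := hP.measure_rect h (A := Function.update (fun _ => Set.univ) j A) (fun i => by
    by_cases hij : i = j
    · subst hij; simpa using hA
    · simp [hij])
  have h2 : {ω : Outcome K X | ω.1 = h ∧ ∀ i, ω.2 i ∈
      Function.update (fun _ => Set.univ : ∀ i, Set (X i)) j A i} =
      latentEvent X Set.univ h ∩ (fun ω : Outcome K X => ω.2 j) ⁻¹' A := by
    ext ω
    have : (∀ i, ω.2 i ∈ Function.update (fun _ => Set.univ : ∀ i, Set (X i)) j A i) ↔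
        ω.2 j ∈ A := by
      refine ⟨fun hh => by simpa using hh j, fun hh i => ?_⟩
      by_cases hij : i = j
      · subst hij; simpa using hh
      · simp [hij]
    simp [latentEvent, funext_iff, this]
  rw [h2, Finset.prod_eq_single j (fun i _ hij => by simp [hij]) (by simp),
    Function.update_self] at h1
  rw [h1, proportion, ← mul_assoc,
    ENNReal.inv_mul_cancel (hP.latentEvent_ne_zero _ _) (measure_ne_top _ _), one_mul]

/-- `P_{j,h}` determines exactly the values in `h` of the parents of `X_j`; through this equivalence
the mixture components carry the matrix `Γ`. -/
lemma IsBLCM.obsLaw_eq_iff (hP : IsBLCM G P) (j : Fin J) (h h' : Fin K → Bool) :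
    obsLaw P j h = obsLaw P j h' ↔ ∀ k, gamma G j k = true → h k = h' k := by
  have hpa : ∀ k, gamma G j k = true ↔ k ∈ latentParents G (Sum.inr j) := fun k => by
    simp [gamma, latentParents]
  rw [hP.obsLaw_eq_condLaw, hP.obsLaw_eq_condLaw]
  simp only [hpa]
  constructor
  · intro heq
    by_contra! hne
    exact hP.condLaw_ne j h h' hne heq
  · intro hh
    rw [condLaw, condLaw, latentEvent_congr hh]

lemma IsBLCM.observed_real_pi (hP : IsBLCM G P) {A : ∀ j, Set (X j)}
    (hA : ∀ j, MeasurableSet (A j)) :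
    (observed P).real (Set.univ.pi A) =
      ∑ h, (proportion P h).toReal * ∏ j, (obsLaw P j h).real (A j) := by
  have := hP.isProbabilityMeasure
  have hpre : (Prod.snd ⁻¹' Set.univ.pi A : Set (Outcome K X)) =
      ⋃ h, {ω | ω.1 = h ∧ ∀ j, ω.2 j ∈ A j} := by
    ext ω
    simp
  have hterm : ∀ h, MeasurableSet {ω : Outcome K X | ω.1 = h ∧ ∀ j, ω.2 j ∈ A j} := fun h => by
    have h1 : {ω : Outcome K X | ω.1 = h ∧ ∀ j, ω.2 j ∈ A j} =
        Prod.fst ⁻¹' {h} ∩ Prod.snd ⁻¹' Set.univ.pi A := by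
      ext ω
      simp
    rw [h1]
    exact (measurable_fst (measurableSet_singleton h)).inter
      (measurable_snd (MeasurableSet.univ_pi hA))
  rw [Measure.real, observed,
    Measure.map_apply measurable_snd (MeasurableSet.univ_pi hA), hpre, measure_iUnion
      (fun h h' hne => Set.disjoint_left.2 fun ω hω hω' => hne (hω.1.symm.trans hω'.1)) hterm,
    tsum_fintype, ENNReal.toReal_sum fun h _ => measure_ne_top _ _]
  refine Finset.sum_congr rfl fun h _ => ?_
  rw [hP.measure_rect h hA, ENNReal.toReal_mul, ENNReal.toReal_prod]
  simp only [hP.obsLaw_eq_condLaw, Measure.real]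

end Mixture

/-! ### Identification of the mixture components -/

section Components

variable {J K : ℕ} {X : Fin J → Type*} [∀ j, MeasurableSpace (X j)]
  {G G' : Digraph (Fin K ⊕ Fin J)} {P P' : Measure (Outcome K X)}

/-- `P(X_j ∈ A j for all j ∈ s | H = h)`, for events `A j` of the observed variables. -/
noncomputable def blockProb (P : Measure (Outcome K X)) (s : Finset (Fin J))
    (A : ∀ j, {B : Set (X j) // MeasurableSet B}) (h : Fin K → Bool) : ℝ :=
  ∏ j ∈ s, (obsLaw P j h).real (A j)

/-- The trivial events. -/
def univEvent (X : Fin J → Type*) [∀ j, MeasurableSpace (X j)] :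
    ∀ j, {B : Set (X j) // MeasurableSet B} :=
  fun _ => ⟨Set.univ, MeasurableSet.univ⟩

lemma IsBLCM.obsLaw_real_univEvent (hP : IsBLCM G P) (j : Fin J) (h : Fin K → Bool) :
    (obsLaw P j h).real (univEvent X j) = 1 := by
  have := hP.isProbabilityMeasure_obsLaw j h
  exact probReal_univ

lemma IsBLCM.blockProb_univEvent (hP : IsBLCM G P) (s : Finset (Fin J)) (h : Fin K → Bool) :
    blockProb P s (univEvent X) h = 1 :=
  Finset.prod_eq_one fun j _ => hP.obsLaw_real_univEvent j h

lemma IsBLCM.blockProb_update (hP : IsBLCM G P) {s : Finset (Fin J)} {j : Fin J} (hj : j ∈ s)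
    (B : {B : Set (X j) // MeasurableSet B}) (h : Fin K → Bool) :
    blockProb P s (Function.update (univEvent X) j B) h = (obsLaw P j h).real B := by
  rw [blockProb, Finset.prod_eq_single j, Function.update_self]
  · intro i _ hij
    rw [Function.update_of_ne hij]
    exact hP.obsLaw_real_univEvent i h
  · exact fun hj' => absurd hj hj'

lemma IsBLCM.exists_obsLaw_real_ne (hP : IsBLCM G P) {j : Fin J} {k : Fin K}
    (hjk : gamma G j k = true) {h h' : Fin K → Bool} (hk : h k ≠ h' k) :
    ∃ B : {B : Set (X j) // MeasurableSet B}, (obsLaw P j h).real B ≠ (obsLaw P j h').real B := by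
  by_contra! hall
  have := hP.isProbabilityMeasure_obsLaw j h
  have := hP.isProbabilityMeasure_obsLaw j h'
  refine hk ((hP.obsLaw_eq_iff j h h').1 (Measure.ext fun B hB => ?_) k hjk)
  exact (measureReal_eq_measureReal_iff).1 (hall ⟨B, hB⟩)

lemma IsBLCM.eq_zero_of_blockProb (hP : IsBLCM G P) (r : Fin K ↪ Fin J)
    (hr : IsTriangular ((gamma G).submatrix r id)) {b : (Fin K → Bool) → ℝ}
    (hb : ∀ A, ∑ h, b h * blockProb P (Finset.univ.map r) A h = 0) : b = 0 := by
  obtain ⟨ρ, c, hdiag, hupper⟩ := hr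
  refine eq_zero_of_triangular (fun j (B : {B : Set (X j) // MeasurableSet B}) h =>
    (obsLaw P j h).real B) (univEvent X) hP.obsLaw_real_univEvent (ρ.toEmbedding.trans r) c
    (fun i A h h' hh => ?_) (fun i h h' hh => hP.exists_obsLaw_real_ne (hdiag i) hh)
    fun A => ?_
  · rw [(hP.obsLaw_eq_iff _ h h').2]
    intro k hk
    obtain ⟨l, rfl⟩ := c.surjective k
    refine hh l (not_lt.1 fun hil => ?_)
    have h0 := hupper i l hil
    simp only [Matrix.submatrix_apply, id] at h0
    exact Bool.false_ne_true (h0.symm.trans hk)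
  · rw [← hb A]
    refine Finset.sum_congr rfl fun h _ => ?_
    rw [blockProb, Finset.prod_map,
      ← Equiv.prod_comp ρ fun i => (obsLaw P (r i) h).real (A (r i))]
    rfl

/-- The two outer blocks are linearly independent in `h` and the third one separates the
configurations, so the mixture components are determined up to their order. -/
theorem exists_perm_components (hP : IsBLCM G P) (hP' : IsBLCM G' P')
    (hobs : observed P = observed P') {r₁ r₂ : Fin K ↪ Fin J}
    (hdouble : IsDoubleTriangularAlong (gamma G) r₁ r₂)
    (hthird : RemainderHasNoEmptyColumn (gamma G) r₁ r₂) :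
    ∃ R : Equiv.Perm (Fin K → Bool), (∀ h, proportion P h = proportion P' (R h)) ∧
      ∀ j h, obsLaw P j h = obsLaw P' j (R h) := by
  classical
  obtain ⟨hdisj, htri₁, htri₂⟩ := hdouble
  have := hP.isProbabilityMeasure
  have := hP'.isProbabilityMeasure
  set s₁ := Finset.univ.map r₁ with hs₁
  set s₂ := Finset.univ.map r₂ with hs₂
  have hs : Disjoint s₁ s₂ := by
    rw [← Finset.disjoint_coe]
    simpa [hs₁, hs₂] using hdisj
  set s₃ := (s₁ ∪ s₂)ᶜ with hs₃
  have hmix : ∀ x y z : ∀ j, {B : Set (X j) // MeasurableSet B},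
      ∑ h, (proportion P h).toReal * blockProb P s₁ x h * blockProb P s₂ y h * blockProb P s₃ z h =
      ∑ h, (proportion P' h).toReal * blockProb P' s₁ x h * blockProb P' s₂ y h *
        blockProb P' s₃ z h := by
    intro x y z
    set A : ∀ j, {B : Set (X j) // MeasurableSet B} :=
      fun j => if j ∈ s₁ then x j else if j ∈ s₂ then y j else z j with hA
    have hsplit : ∀ (P : Measure (Outcome K X)) h, ∏ j, (obsLaw P j h).real (A j) =
        blockProb P s₁ x h * blockProb P s₂ y h * blockProb P s₃ z h := by
      intro P h
      rw [← Finset.prod_mul_prod_compl (s₁ ∪ s₂), Finset.prod_union hs]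
      refine congr_arg₂ _ (congr_arg₂ _ ?_ ?_) ?_ <;>
        refine Finset.prod_congr rfl fun j hj => ?_
      · simp only [hA, if_pos hj]
      · simp only [hA, if_pos hj, if_neg (Finset.disjoint_right.1 hs hj)]
      · simp only [hs₃, Finset.mem_compl, Finset.mem_union, not_or] at hj
        simp only [hA, if_neg hj.1, if_neg hj.2]
    have h1 := hP.observed_real_pi fun j => (A j).2
    rw [hobs, hP'.observed_real_pi fun j => (A j).2] at h1
    simp only [hsplit, ← mul_assoc] at h1
    exact h1.symm
  have hπ : ∀ {Q : Measure (Outcome K X)} [IsProbabilityMeasure Q] h, proportion Q h ≠ ⊤ :=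
    fun h => measure_ne_top _ _
  obtain ⟨R, hRπ, hR₁, hR₂, hR₃⟩ := exists_perm_of_sum_eq
    (fun h => (ENNReal.toReal_pos (hP.proportion_pos h).ne' (hπ h)).ne')
    (fun b hb => hP.eq_zero_of_blockProb r₁ htri₁ hb)
    (fun b hb => hP.eq_zero_of_blockProb r₂ htri₂ hb)
    (fun h h' hh => by
      by_contra hne
      obtain ⟨k, hk⟩ := Function.ne_iff.1 hne
      obtain ⟨j, hj₁, hj₂, hjk⟩ := hthird k
      have hj : j ∈ s₃ := by
        simpa [hs₁, hs₂, hs₃] using And.intro hj₁ hj₂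
      obtain ⟨B, hB⟩ := hP.exists_obsLaw_real_ne hjk hk
      have := hh (Function.update (univEvent X) j B)
      rw [hP.blockProb_update hj, hP.blockProb_update hj] at this
      exact hB this)
    (hP.blockProb_univEvent s₁) (hP'.blockProb_univEvent s₁)
    (hP.blockProb_univEvent s₂) (hP'.blockProb_univEvent s₂)
    (hP.blockProb_univEvent s₃) (hP'.blockProb_univEvent s₃) hmix
  have hlaw : ∀ s, (∀ A h, blockProb P s A h = blockProb P' s A (R h)) →
      ∀ j ∈ s, ∀ h, obsLaw P j h = obsLaw P' j (R h) := by
    intro s hRs j hj h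
    have := hP.isProbabilityMeasure_obsLaw j h
    have := hP'.isProbabilityMeasure_obsLaw j (R h)
    refine Measure.ext fun B hB => (measureReal_eq_measureReal_iff).1 ?_
    have := hRs (Function.update (univEvent X) j ⟨B, hB⟩) h
    rwa [hP.blockProb_update hj, hP'.blockProb_update hj] at this
  refine ⟨R, fun h => (ENNReal.toReal_eq_toReal_iff' (hπ h) (hπ _)).1 (hRπ h), fun j => ?_⟩
  by_cases hj₁ : j ∈ s₁
  · exact hlaw s₁ hR₁ j hj₁
  by_cases hj₂ : j ∈ s₂
  · exact hlaw s₂ hR₂ j hj₂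
  · exact hlaw s₃ hR₃ j (by simp [hs₃, hj₁, hj₂])

end Components

/-! ### Identification of the latent graph -/

section LatentGraph

variable {J K : ℕ} {X : Fin J → Type*} [∀ j, MeasurableSpace (X j)]
  {G G' : Digraph (Fin K ⊕ Fin J)} {P P' : Measure (Outcome K X)}

lemma IsBLCM.condIndep_inl_iff_dSep (hP : IsBLCM G P) {A B C : Set (Fin K)} (hAB : Disjoint A B)
    (hAC : Disjoint A C) (hBC : Disjoint B C) :
    CondIndep P (Sum.inl '' A) (Sum.inl '' B) (Sum.inl '' C) ↔ DSep (latentGraph G) A B C := by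
  rw [hP.faithful _ _ _ ((Set.disjoint_image_iff Sum.inl_injective).2 hAB)
    ((Set.disjoint_image_iff Sum.inl_injective).2 hAC)
    ((Set.disjoint_image_iff Sum.inl_injective).2 hBC), dSep_inl_iff hP.measurement]

/-- By faithfulness the latent graph determines, and is determined up to Markov equivalence by, the
conditional independences of the latent variables. -/
lemma markovEquivAlong_of_relabel (hP : IsBLCM G P) (hP' : IsBLCM G' P')
    {R : Equiv.Perm (Fin K → Bool)} {σ : Equiv.Perm (Fin K)}
    (hπ : ∀ h, proportion P h = proportion P' (R h))
    (hR : ∀ k h h', R h (σ k) = R h' (σ k) ↔ h k = h' k) :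
    MarkovEquivAlong σ (latentGraph G) (latentGraph G') := by
  have := hP.isProbabilityMeasure
  have := hP'.isProbabilityMeasure
  intro A B C hAB hAC hBC
  rw [← hP.condIndep_inl_iff_dSep hAB hAC hBC, ← hP'.condIndep_inl_iff_dSep
    ((Set.disjoint_image_iff σ.injective).2 hAB) ((Set.disjoint_image_iff σ.injective).2 hAC)
    ((Set.disjoint_image_iff σ.injective).2 hBC)]
  refine ⟨CondIndep.of_relabel hP.proportion_pos hP'.proportion_pos hπ hR, fun hCI => ?_⟩
  have := CondIndep.of_relabel hP'.proportion_pos hP.proportion_pos (R := R.symm) (σ := σ.symm)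
    (fun h => by rw [hπ, R.apply_symm_apply])
    (fun k h h' => by
      rw [← hR, R.apply_symm_apply, R.apply_symm_apply, σ.apply_symm_apply]) hCI
  simpa only [Equiv.symm_image_image] using this

end LatentGraph

end BLCM

theorem theorem3p4 {J K : ℕ} {X : Fin J → Type*}
    [∀ j, MetricSpace (X j)] [∀ j, TopologicalSpace.SeparableSpace (X j)] [∀ j, Nontrivial (X j)]
    [∀ j, MeasurableSpace (X j)] [∀ j, BorelSpace (X j)]
    (G : Digraph (Fin K ⊕ Fin J)) (P : MeasureTheory.Measure (BLCM.Outcome K X))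
    (hP : BLCM.IsBLCM G P)
    (r₁ r₂ : Fin K ↪ Fin J)
    (hdouble : BLCM.IsDoubleTriangularAlong (BLCM.gamma G) r₁ r₂)
    (hthird : BLCM.RemainderHasNoEmptyColumn (BLCM.gamma G) r₁ r₂) :
    BLCM.GammaIdentifiable G P ∧
      (BLCM.SubsetCondition (BLCM.gamma G) → BLCM.ComponentsIdentifiable G P) := by
  have key : ∀ G' P', BLCM.IsBLCM G' P' → BLCM.observed P = BLCM.observed P' →
      ∃ R : Equiv.Perm (Fin K → Bool),
        (∀ h, BLCM.proportion P h = BLCM.proportion P' (R h)) ∧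
        (∀ j h, BLCM.obsLaw P j h = BLCM.obsLaw P' j (R h)) ∧
        ∀ j h h', (∀ k, BLCM.gamma G j k = true → h k = h' k) ↔
          ∀ k, BLCM.gamma G' j k = true → R h k = R h' k := by
    intro G' P' hP' hobs
    obtain ⟨R, hπ, hlaw⟩ := BLCM.exists_perm_components hP hP' hobs hdouble hthird
    refine ⟨R, hπ, hlaw, fun j h h' => ?_⟩
    rw [← hP.obsLaw_eq_iff, ← hP'.obsLaw_eq_iff, hlaw, hlaw]
  constructor
  · intro G' P' hP' hobs
    obtain ⟨R, -, -, hR⟩ := key G' P' hP' hobs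
    exact BLCM.exists_perm_columns hR
  · intro hsub G' P' hP' hobs
    obtain ⟨R, hπ, hlaw, hR⟩ := key G' P' hP' hobs
    obtain ⟨σ, hσ⟩ := BLCM.exists_perm_columns hR
    have hcoord := BLCM.apply_eq_iff hsub hσ hR
    obtain ⟨τ, hτ⟩ := BLCM.exists_relabel_eq hcoord
    exact ⟨σ, τ, hσ, BLCM.markovEquivAlong_of_relabel hP hP' hπ hcoord,
      fun h => by rw [hπ, hτ], fun j h => by rw [hlaw, hτ]⟩
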